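/- **Setting.** Let $p_g,p_s\in(0,1]$ and $\alpha\in(0,1]$ with $(p_g,\alpha)\ne(1,1)$. The version age $\Delta(t)\in\{0,1,2,\dots\}$, $t=0,1,2,\dots$, starts at an arbitrary fixed $\Delta(0)=s_0$. In each slot $t$ an action $a(t)\in\{0,1\}$ is chosen ($1$ = transmit). The transmission succeeds with probability $p_s$, a new version is generated with probability $p_g$, independently of each other and of the past. If $a(t)=1$ and the transmission succeeds, then $\Delta(t+1)=g(t)$, otherwise $\Delta(t+1)=\Delta(t)+g(t)$, where $g(t)\in\{0,1\}$ indicates a new version. A policy chooses the law of $a(t)$ as a function of $(\Delta(0),a(0),\dots,\Delta(t-1),a(t-1),\Delta(t))$. A mixed policy draws one policy at random from a (discrete) distribution before slot $0$ and uses it for ever. A (mixed) policy is feasible if $$\limsup_{T\to\infty}\frac1T\,\mathbb E\Big[\sum_{t=0}^{T-1}a(t)\Big]\le\alpha .$$ The policy with threshold $n\in\{0,1,2,\dots\}$ takes $a(t)=1$ if and only if $\Delta(t)\ge n$. Put $\beta=1-(1-p_s)(1-p_g)$, $R(0)=1$, $R(n)=\dfrac{p_g}{(n-1)p_s+\beta}$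 for $n\ge1$, and $$\Delta_T^\ast=\Big\lceil\frac{p_g}{p_s}\Big(\frac1\alpha-1+p_s\Big)\Big\rceil,\qquad \gamma=\frac{R(\Delta_T^\ast-1)-\alpha}{R(\Delta_T^\ast-1)-R(\Delta_T^\ast)} .$$ **Theorem.** For every initial state $s_0$: 1. For every $n\ge0$, the long-run average update rate $\lim_{T\to\infty}\frac1T\mathbb E\sum_{t<T}a(t)$ of the policy with threshold $n$ exists and equals $R(n)$. 2. $\Delta_T^\ast\ge1$, $R(\Delta_T^\ast)<R(\Delta_T^\ast-1)$, and $0\le\gamma\le1$. 3. The policy with threshold $\Delta_T^\ast$ is feasible, and its long-run average version age is at most that of every feasible policy with a single threshold (limit superior of the averages of the former against limit inferior of those of the latter). 4. Let the mixture use the threshold $\Delta_T^\ast$ with probability $\gamma$ and the threshold $\Delta_T^\ast-1$ with probability $1-\gamma$ (one draw, before slot $0$). Its long-run average update rate exists and equals $\alpha$. Its long-run average version age $J=\lim_{T\to\infty}\frac1T\mathbb E\sum_{t<T}\Delta(t)$ exists and is finite, and it is optimal: every feasible mixed policy satisfies $\liminf_{T\to\infty}\frac1T\mathbb E\sum_{t<T}\Delta(t)\ge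 J$. -/

import Mathlib

open Filter Topology
open scoped ENNReal NNReal

noncomputable section

namespace VAoI

/-- The law of a `{0, 1}`-valued variable that equals `1` (that is, `true`) with probability `p`. -/
def coin (p : unitInterval) : PMF Bool :=
  PMF.ofFintype (fun b => ENNReal.ofReal (if b then (p : ℝ) else 1 - p)) (by
    rw [Fintype.sum_bool, ← ENNReal.ofReal_add] <;> simp [p.2.1, p.2.2])

/-- One slot of the dynamics. `a`: an update is transmitted; `c`: the erasure channel delivers in
this slot; `g`: the source generates a new version in this slot (counted from the next slot on).
A delivered update brings the receiver to the version held by the source at the start of the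
slot. -/
def step (Δ : ℕ) (a c g : Bool) : ℕ :=
  (if a && c then 0 else Δ) + (if g then 1 else 0)

/-- Transition law of the version age, given the current version age `Δ` and the action `a`:
the generation (probability `pg`) and the channel (success probability `ps`) are independent. -/
def transition (pg ps : unitInterval) (Δ : ℕ) (a : Bool) : PMF ℕ :=
  (coin ps).bind fun c => (coin pg).map fun g => step Δ a c g

/-- A history-dependent randomized policy: given the list of the past (version age, action) pairs,
most recent first, and the current version age, the law of the current action
(`true` = transmit). The time is the length of the list. -/
abbrev Policy : Type := List (ℕ × Bool) → ℕ → PMF Bool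

/-- A mixed policy: a policy is drawn once, before slot `0`, and is used for ever. -/
abbrev MixedPolicy : Type := PMF Policy

/-- Law of (past pairs, current version age) at the start of slot `t` under `π`, when the version
age in slot `0` is `s₀`. -/
def historyLaw (pg ps : unitInterval) (π : Policy) (s₀ : ℕ) : ℕ → PMF (List (ℕ × Bool) × ℕ)
  | 0 => PMF.pure ([], s₀)
  | t + 1 => (historyLaw pg ps π s₀ t).bind fun x =>
      (π x.1 x.2).bind fun a =>
        (transition pg ps x.2 a).map fun s' => ((x.2, a) :: x.1, s')

/-- Joint law of the version age and the action in slot `t` under the policy `π`. -/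
def slotLaw (pg ps : unitInterval) (π : Policy) (s₀ t : ℕ) : PMF (ℕ × Bool) :=
  (historyLaw pg ps π s₀ t).bind fun x => (π x.1 x.2).map fun a => (x.2, a)

/-- Joint law of the version age and the action in slot `t` under the mixed policy `m`. -/
def mixedSlotLaw (pg ps : unitInterval) (m : MixedPolicy) (s₀ t : ℕ) : PMF (ℕ × Bool) :=
  m.bind fun π => slotLaw pg ps π s₀ t

/-- Expectation of a nonnegative function under a discrete law. -/
def expect {X : Type} (p : PMF X) (f : X → ℝ≥0∞) : ℝ≥0∞ := ∑' x, p x * f x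

/-- `(1/T) E[∑_{t<T} Δ(t)]` -/
def avgAge (pg ps : unitInterval) (m : MixedPolicy) (s₀ T : ℕ) : ℝ≥0∞ :=
  (∑ t ∈ Finset.range T, expect (mixedSlotLaw pg ps m s₀ t) fun x => (x.1 : ℝ≥0∞)) / T

/-- `(1/T) E[∑_{t<T} a(t)]` -/
def avgRate (pg ps : unitInterval) (m : MixedPolicy) (s₀ T : ℕ) : ℝ≥0∞ :=
  (∑ t ∈ Finset.range T,
    expect (mixedSlotLaw pg ps m s₀ t) fun x => if x.2 then 1 else 0) / T

/-- The average update rate constraint. The limit superior is taken, so that a policy whose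
long-run rate does not converge is also admitted. -/
def IsFeasible (pg ps : unitInterval) (α : ℝ) (s₀ : ℕ) (m : MixedPolicy) : Prop :=
  limsup (avgRate pg ps m s₀) atTop ≤ ENNReal.ofReal α

/-- `m` solves the constrained problem: it is feasible, its long-run average version age exists
and is finite, and no feasible policy does better, not even in the sense of the limit inferior. -/
def IsOptimal (pg ps : unitInterval) (α : ℝ) (s₀ : ℕ) (m : MixedPolicy) : Prop :=
  IsFeasible pg ps α s₀ m ∧
    ∃ J : ℝ≥0, Tendsto (avgAge pg ps m s₀) atTop (𝓝 (J : ℝ≥0∞)) ∧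
      ∀ m' : MixedPolicy, IsFeasible pg ps α s₀ m' →
        (J : ℝ≥0∞) ≤ liminf (avgAge pg ps m' s₀) atTop

/-- The threshold policy: transmit exactly when the version age is at least `n`. -/
def threshold (n : ℕ) : Policy := fun _ Δ => PMF.pure (decide (n ≤ Δ))

/-- The randomized mixture of two policies: `π₁` with probability `γ`, `π₂` with `1 - γ`. -/
def mixture (γ : unitInterval) (π₁ π₂ : Policy) : MixedPolicy :=
  (coin γ).map fun b => if b then π₁ else π₂

/-- `R(0) = 1` and `R(n) = p_g / ((n - 1) p_s + β)` for `n ≥ 1`,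
where `β = 1 - (1 - p_s)(1 - p_g)`. -/
def R (pg ps : ℝ) (n : ℕ) : ℝ :=
  if n = 0 then 1 else pg / (((n : ℝ) - 1) * ps + (1 - (1 - ps) * (1 - pg)))

/-- `⌈(p_g / p_s) (1 / α - 1 + p_s)⌉` -/
def optThreshold (pg ps α : ℝ) : ℕ := ⌈pg / ps * (1 / α - 1 + ps)⌉₊

/-- `(R(n - 1) - α) / (R(n - 1) - R(n))` at the optimal threshold `n`. -/
def optGamma (pg ps α : ℝ) : ℝ :=
  (R pg ps (optThreshold pg ps α - 1) - α) /
    (R pg ps (optThreshold pg ps α - 1) - R pg ps (optThreshold pg ps α))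

end VAoI

end

noncomputable section

namespace VAoI

/-! ### Expectations under discrete laws -/

section Expect

variable {X Y : Type}

/-! The argument is Lagrangian. Charge a price `multiplier n` per update. With θ = `gain n` and h =
`costValue n`, the inequality θ + h(Δ) ≤ Δ + price·a + E h(next age) holds for both actions
(`poisson_le`). Idling gives equality for Δ ≤ n and transmitting for Δ ≥ n, so the thresholds n and
n + 1 both attain it in every state (`poisson_threshold`).

Summing expectations over t < T telescopes h and leaves the remainder E h(Δ_T)/T. Since h grows
linearly, it suffices that E Δ_T / T is small. This holds whenever the average age up to T is
bounded: the mean age rises by at most one per slot, so a large final value forces a large sum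
before it (`mul_le_sum_add_sq`). Hence every feasible mixed policy has limit inferior at least `gain
n - multiplier n * α` (`lagrangianBound_le_liminf`), while the threshold k ∈ {n, n + 1} has limiting
age `gain n - multiplier n * R k`. The rate limit R(k) comes from a second Poisson equation, with
bounded solution `rateValue`.

Take n + 1 to be the optimal threshold, so that R(n + 1) ≤ α ≤ R(n). Mixing the two thresholds to
rate exactly α attains the bound, because the limiting age is affine in the rate at a fixed price.
For single thresholds, neighbours share a price, so their limiting ages increase as R decreases
(`thresholdCost_monotone`). -/

lemma expect_pure (x : X) (f : X → ℝ≥0∞) : expect (PMF.pure x) f = f x := by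
  unfold expect
  rw [tsum_eq_single x (by intro y hy; simp [PMF.pure_apply, hy])]
  simp

lemma expect_bind (p : PMF X) (q : X → PMF Y) (f : Y → ℝ≥0∞) :
    expect (p.bind q) f = expect p fun x => expect (q x) f := by
  simp only [expect, PMF.bind_apply, ← ENNReal.tsum_mul_right, ← ENNReal.tsum_mul_left]
  rw [ENNReal.tsum_comm]
  simp only [mul_assoc]

lemma expect_map (p : PMF X) (g : X → Y) (f : Y → ℝ≥0∞) :
    expect (p.map g) f = expect p fun x => f (g x) := by
  rw [← PMF.bind_pure_comp, expect_bind]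
  simp [expect_pure]

lemma expect_add (p : PMF X) (f g : X → ℝ≥0∞) :
    expect p (fun x => f x + g x) = expect p f + expect p g := by
  simp only [expect, mul_add, ENNReal.tsum_add]

lemma expect_const_mul (p : PMF X) (c : ℝ≥0∞) (f : X → ℝ≥0∞) :
    expect p (fun x => c * f x) = c * expect p f := by
  simp only [expect, ← ENNReal.tsum_mul_left, mul_left_comm]

lemma expect_const (p : PMF X) (c : ℝ≥0∞) : expect p (fun _ => c) = c := by
  simp [expect, ENNReal.tsum_mul_right, p.tsum_coe]

lemma expect_mono_support (p : PMF X) {f g : X → ℝ≥0∞} (h : ∀ x ∈ p.support, f x ≤ g x) :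
    expect p f ≤ expect p g := by
  refine ENNReal.tsum_le_tsum fun x => ?_
  by_cases hx : x ∈ p.support
  · gcongr
    exact h x hx
  · simp [(p.apply_eq_zero_iff x).2 hx]

lemma expect_mono (p : PMF X) {f g : X → ℝ≥0∞} (h : ∀ x, f x ≤ g x) :
    expect p f ≤ expect p g :=
  expect_mono_support p fun x _ => h x

lemma expect_coin (p : unitInterval) (f : Bool → ℝ≥0∞) :
    expect (coin p) f =
      ENNReal.ofReal p * f true + ENNReal.ofReal (1 - p) * f false := by
  simp [expect, coin]

end Expect

/-! ### One slot of the dynamics -/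

/-- Expected value of `h` at the next version age, as a real number. -/
def nextMean (pg ps : ℝ) (h : ℕ → ℝ) (Δ : ℕ) (a : Bool) : ℝ :=
  ps * (pg * h (step Δ a true true) + (1 - pg) * h (step Δ a true false)) +
    (1 - ps) * (pg * h (step Δ a false true) + (1 - pg) * h (step Δ a false false))

variable (pg ps : unitInterval)

lemma nextMean_nonneg {h : ℕ → ℝ} (hh : ∀ n, 0 ≤ h n) (Δ : ℕ) (a : Bool) :
    0 ≤ nextMean pg ps h Δ a := by
  have h1 := pg.2.1
  have h2 := ps.2.1
  have h3 := sub_nonneg.2 pg.2.2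
  have h4 := sub_nonneg.2 ps.2.2
  have := hh (step Δ a true true)
  have := hh (step Δ a true false)
  have := hh (step Δ a false true)
  have := hh (step Δ a false false)
  unfold nextMean
  positivity

lemma expect_transition {h : ℕ → ℝ} (hh : ∀ n, 0 ≤ h n) (Δ : ℕ) (a : Bool) :
    expect (transition pg ps Δ a) (fun s => ENNReal.ofReal (h s)) =
      ENNReal.ofReal (nextMean pg ps h Δ a) := by
  have h1 := pg.2.1
  have h2 := ps.2.1
  have h3 := sub_nonneg.2 pg.2.2
  have h4 := sub_nonneg.2 ps.2.2
  have := hh (step Δ a true true)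
  have := hh (step Δ a true false)
  have := hh (step Δ a false true)
  have := hh (step Δ a false false)
  simp only [transition, expect_bind, expect_map, expect_coin, nextMean]
  rw [ENNReal.ofReal_add (by positivity) (by positivity), ENNReal.ofReal_mul h2,
    ENNReal.ofReal_mul h4, ENNReal.ofReal_add (by positivity) (by positivity),
    ENNReal.ofReal_add (by positivity) (by positivity), ENNReal.ofReal_mul h1,
    ENNReal.ofReal_mul h3, ENNReal.ofReal_mul h1, ENNReal.ofReal_mul h3]

/-! ### Laws of the slots -/

/-- The past enters the next age only through the current age and action. The history can therefore
be summed out even for history-dependent policies, and all later estimates use only the slot laws.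
-/
lemma expect_slotLaw_succ (π : Policy) (s₀ t : ℕ) (f : ℕ → ℝ≥0∞) :
    expect (slotLaw pg ps π s₀ (t + 1)) (fun x => f x.1) =
      expect (slotLaw pg ps π s₀ t) fun x => expect (transition pg ps x.1 x.2) f := by
  simp only [slotLaw, historyLaw, expect_bind, expect_map, expect_const]

lemma expect_mixedSlotLaw_zero (m : MixedPolicy) (s₀ : ℕ) (f : ℕ → ℝ≥0∞) :
    expect (mixedSlotLaw pg ps m s₀ 0) (fun x => f x.1) = f s₀ := by
  simp only [mixedSlotLaw, slotLaw, historyLaw, expect_bind, expect_map, expect_const, expect_pure]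

lemma expect_mixedSlotLaw_succ (m : MixedPolicy) (s₀ t : ℕ) (f : ℕ → ℝ≥0∞) :
    expect (mixedSlotLaw pg ps m s₀ (t + 1)) (fun x => f x.1) =
      expect (mixedSlotLaw pg ps m s₀ t) fun x => expect (transition pg ps x.1 x.2) f := by
  simp only [mixedSlotLaw, expect_bind, expect_slotLaw_succ]

lemma expect_mixedSlotLaw_mixture (γ : unitInterval) (π₁ π₂ : Policy) (s₀ t : ℕ)
    (f : ℕ × Bool → ℝ≥0∞) :
    expect (mixedSlotLaw pg ps (mixture γ π₁ π₂) s₀ t) f =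
      ENNReal.ofReal γ * expect (mixedSlotLaw pg ps (PMF.pure π₁) s₀ t) f +
        ENNReal.ofReal (1 - γ) * expect (mixedSlotLaw pg ps (PMF.pure π₂) s₀ t) f := by
  simp [mixedSlotLaw, mixture, expect_bind, expect_coin]

lemma action_of_mem_support_threshold {n s₀ t : ℕ} {x : ℕ × Bool}
    (hx : x ∈ (mixedSlotLaw pg ps (PMF.pure (threshold n)) s₀ t).support) :
    x.2 = decide (n ≤ x.1) := by
  simp only [mixedSlotLaw, PMF.pure_bind, slotLaw, threshold, PMF.pure_map,
    PMF.mem_support_bind_iff, PMF.mem_support_pure_iff] at hx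
  obtain ⟨y, -, rfl⟩ := hx
  rfl

/-! ### Mean values -/

/-- Mean of a nonnegative real function of version age and action in slot `t`. -/
def mean (m : MixedPolicy) (s₀ t : ℕ) (f : ℕ × Bool → ℝ) : ℝ :=
  (expect (mixedSlotLaw pg ps m s₀ t) fun x => ENNReal.ofReal (f x)).toReal

/-- Mean version age in slot `t`. -/
def meanAge (m : MixedPolicy) (s₀ t : ℕ) : ℝ := mean pg ps m s₀ t fun x => x.1

/-- The action as a real number. -/
def actionValue (a : Bool) : ℝ := if a then 1 else 0

lemma actionValue_nonneg (a : Bool) : 0 ≤ actionValue a := by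
  unfold actionValue; split_ifs <;> norm_num

lemma actionValue_le_one (a : Bool) : actionValue a ≤ 1 := by
  unfold actionValue; split_ifs <;> norm_num

/-- Probability of an update in slot `t`. -/
def meanRate (m : MixedPolicy) (s₀ t : ℕ) : ℝ := mean pg ps m s₀ t fun x => actionValue x.2

/-- Functions of at most linear growth in the version age. -/
def LinearGrowth (f : ℕ × Bool → ℝ) : Prop := ∃ C : ℝ, 0 ≤ C ∧ ∀ x, f x ≤ C * (x.1 + 1)

variable {pg ps} {m : MixedPolicy} {s₀ t : ℕ}

lemma expect_age_le (pg ps : unitInterval) (m : MixedPolicy) (s₀ t : ℕ) :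
    expect (mixedSlotLaw pg ps m s₀ t) (fun x => (x.1 : ℝ≥0∞)) ≤ (s₀ + t : ℕ) := by
  induction t with
  | zero => rw [expect_mixedSlotLaw_zero pg ps m s₀ fun n => (n : ℝ≥0∞)]; simp
  | succ t ih =>
    rw [expect_mixedSlotLaw_succ pg ps m s₀ t fun n => (n : ℝ≥0∞)]
    have key : ∀ x : ℕ × Bool,
        expect (transition pg ps x.1 x.2) (fun n => (n : ℝ≥0∞)) ≤ (x.1 : ℝ≥0∞) + 1 := by
      intro x
      rw [← expect_const (transition pg ps x.1 x.2) ((x.1 : ℝ≥0∞) + 1)]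
      simp only [transition, expect_bind, expect_map]
      refine expect_mono _ fun c => expect_mono _ fun g => ?_
      have : step x.1 x.2 c g ≤ x.1 + 1 := by
        unfold step; split_ifs <;> omega
      exact_mod_cast this
    refine (expect_mono _ key).trans ?_
    rw [expect_add, expect_const, ← add_assoc, Nat.cast_add (s₀ + t) 1, Nat.cast_one]
    gcongr

/-- The age gains at most one per slot, so its mean is at most `s₀ + t`. Finiteness is what makes
`toReal` additive and monotone on the means below. -/
lemma LinearGrowth.expect_ne_top {f : ℕ × Bool → ℝ} (hf : LinearGrowth f) :
    expect (mixedSlotLaw pg ps m s₀ t) (fun x => ENNReal.ofReal (f x)) ≠ ⊤ := by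
  obtain ⟨C, hC0, hC⟩ := hf
  refine ne_top_of_le_ne_top (b := ENNReal.ofReal C * ((s₀ + t : ℕ) + 1))
    (by finiteness) ?_
  have : ∀ x : ℕ × Bool, ENNReal.ofReal (f x) ≤ ENNReal.ofReal C * ((x.1 : ℝ≥0∞) + 1) := by
    intro x
    refine (ENNReal.ofReal_le_ofReal (hC x)).trans (le_of_eq ?_)
    rw [ENNReal.ofReal_mul hC0, ENNReal.ofReal_add (by positivity)
      (by positivity), ENNReal.ofReal_natCast, ENNReal.ofReal_one]
  refine (expect_mono _ this).trans ?_
  rw [expect_const_mul, expect_add, expect_const]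
  gcongr
  exact expect_age_le pg ps m s₀ t

lemma linearGrowth_age : LinearGrowth fun x => x.1 :=
  ⟨1, zero_le_one, fun x => by simp⟩

lemma linearGrowth_of_le {f : ℕ × Bool → ℝ} {B : ℝ} (hB : 0 ≤ B) (h : ∀ x, f x ≤ B) :
    LinearGrowth f :=
  ⟨B, hB, fun x => (h x).trans (by
    have : (0 : ℝ) ≤ B * x.1 := by positivity
    linarith)⟩

lemma LinearGrowth.add {f g : ℕ × Bool → ℝ} (hf : LinearGrowth f) (hg : LinearGrowth g) :
    LinearGrowth fun x => f x + g x := by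
  obtain ⟨C, hC0, hC⟩ := hf
  obtain ⟨D, hD0, hD⟩ := hg
  exact ⟨C + D, add_nonneg hC0 hD0, fun x => by linarith [hC x, hD x]⟩

lemma LinearGrowth.const_mul {f : ℕ × Bool → ℝ} (hf : LinearGrowth f) {c : ℝ} (hc : 0 ≤ c) :
    LinearGrowth fun x => c * f x := by
  obtain ⟨C, hC0, hC⟩ := hf
  refine ⟨c * C, mul_nonneg hc hC0, fun x => ?_⟩
  rw [mul_assoc]
  exact mul_le_mul_of_nonneg_left (hC x) hc

lemma linearGrowth_action : LinearGrowth fun x => actionValue x.2 :=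
  linearGrowth_of_le zero_le_one fun x => actionValue_le_one x.2

lemma mean_nonneg {f : ℕ × Bool → ℝ} : 0 ≤ mean pg ps m s₀ t f := ENNReal.toReal_nonneg

lemma mean_mono_support {f g : ℕ × Bool → ℝ} (hg : LinearGrowth g)
    (h : ∀ x ∈ (mixedSlotLaw pg ps m s₀ t).support, f x ≤ g x) :
    mean pg ps m s₀ t f ≤ mean pg ps m s₀ t g :=
  ENNReal.toReal_mono hg.expect_ne_top
    (expect_mono_support _ fun x hx => ENNReal.ofReal_le_ofReal (h x hx))

lemma mean_add {f g : ℕ × Bool → ℝ} (hf : LinearGrowth f) (hg : LinearGrowth g)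
    (hf0 : ∀ x, 0 ≤ f x) (hg0 : ∀ x, 0 ≤ g x) :
    mean pg ps m s₀ t (fun x => f x + g x) = mean pg ps m s₀ t f + mean pg ps m s₀ t g := by
  simp only [mean, fun x => ENNReal.ofReal_add (hf0 x) (hg0 x), expect_add]
  exact ENNReal.toReal_add hf.expect_ne_top hg.expect_ne_top

lemma mean_const_mul {f : ℕ × Bool → ℝ} {c : ℝ} (hc : 0 ≤ c) :
    mean pg ps m s₀ t (fun x => c * f x) = c * mean pg ps m s₀ t f := by
  simp only [mean, ENNReal.ofReal_mul hc, expect_const_mul, ENNReal.toReal_mul,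
    ENNReal.toReal_ofReal hc]

lemma mean_const {c : ℝ} (hc : 0 ≤ c) : mean pg ps m s₀ t (fun _ => c) = c := by
  simp only [mean, expect_const, ENNReal.toReal_ofReal hc]

lemma mean_zero {h : ℕ → ℝ} (hh : ∀ n, 0 ≤ h n) :
    mean pg ps m s₀ 0 (fun x => h x.1) = h s₀ := by
  rw [mean, expect_mixedSlotLaw_zero pg ps m s₀ fun n => ENNReal.ofReal (h n),
    ENNReal.toReal_ofReal (hh _)]

lemma mean_succ {h : ℕ → ℝ} (hh : ∀ n, 0 ≤ h n) :
    mean pg ps m s₀ (t + 1) (fun x => h x.1) =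
      mean pg ps m s₀ t fun x => nextMean pg ps h x.1 x.2 := by
  rw [mean, expect_mixedSlotLaw_succ pg ps m s₀ t fun n => ENNReal.ofReal (h n)]
  simp only [expect_transition pg ps hh, mean]

lemma nextMean_le {h : ℕ → ℝ} {B : ℝ} {Δ : ℕ} (hB : ∀ n ≤ Δ + 1, h n ≤ B) (a : Bool) :
    nextMean pg ps h Δ a ≤ B := by
  have h1 := pg.2.1
  have h2 := ps.2.1
  have h3 := sub_nonneg.2 pg.2.2
  have h4 := sub_nonneg.2 ps.2.2
  have key : ∀ c g, h (step Δ a c g) ≤ B := fun c g => hB _ (by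
    unfold step; split_ifs <;> omega)
  calc nextMean pg ps h Δ a
      ≤ ps * (pg * B + (1 - pg) * B) + (1 - ps) * (pg * B + (1 - pg) * B) := by
        unfold nextMean
        gcongr <;> exact key _ _
    _ = B := by ring

lemma LinearGrowth.nextMean {h : ℕ → ℝ} (hh : LinearGrowth fun x => h x.1) :
    LinearGrowth fun x => nextMean pg ps h x.1 x.2 := by
  obtain ⟨C, hC0, hC⟩ := hh
  refine ⟨2 * C, by positivity, fun x => nextMean_le (fun n hn => (hC (n, true)).trans ?_) _⟩
  have : (n : ℝ) ≤ x.1 + 1 := by exact_mod_cast hn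
  have h0 : (0 : ℝ) ≤ x.1 := by positivity
  calc C * (n + 1) ≤ C * (2 * (x.1 + 1)) := by gcongr; linarith
    _ = _ := by ring

lemma meanAge_succ_le : meanAge pg ps m s₀ (t + 1) ≤ meanAge pg ps m s₀ t + 1 := by
  have h0 : ∀ n : ℕ, (0 : ℝ) ≤ n := fun n => Nat.cast_nonneg n
  rw [meanAge, mean_succ h0, meanAge, ← mean_const (pg := pg) (ps := ps) (m := m) (s₀ := s₀)
    (t := t) zero_le_one, ← mean_add linearGrowth_age (linearGrowth_of_le zero_le_one fun _ => le_rfl)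
    (fun _ => h0 _) (fun _ => zero_le_one)]
  refine mean_mono_support (linearGrowth_age.add (linearGrowth_of_le zero_le_one fun _ => le_rfl))
    fun x _ => nextMean_le (fun n hn => by exact_mod_cast hn) _

lemma avgAge_ne_top {T : ℕ} : avgAge pg ps m s₀ T ≠ ⊤ := by
  rcases Nat.eq_zero_or_pos T with rfl | hT
  · simp [avgAge]
  · refine ENNReal.div_ne_top (ENNReal.sum_ne_top.2 fun t _ => ?_) (by simp; omega)
    exact ne_top_of_le_ne_top (ENNReal.natCast_ne_top _) (expect_age_le pg ps m s₀ t)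

lemma ofReal_actionValue (a : Bool) :
    ENNReal.ofReal (actionValue a) = if a then 1 else 0 := by
  cases a <;> simp [actionValue]

lemma avgRate_ne_top {T : ℕ} : avgRate pg ps m s₀ T ≠ ⊤ := by
  rcases Nat.eq_zero_or_pos T with rfl | hT
  · simp [avgRate]
  · refine ENNReal.div_ne_top (ENNReal.sum_ne_top.2 fun t _ => ?_) (by simp; omega)
    simpa only [ofReal_actionValue] using
      linearGrowth_action.expect_ne_top (pg := pg) (ps := ps) (m := m) (s₀ := s₀) (t := t)

lemma toReal_avgAge {T : ℕ} :
    (avgAge pg ps m s₀ T).toReal = (∑ t ∈ Finset.range T, meanAge pg ps m s₀ t) / T := by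
  have key : ∀ t, expect (mixedSlotLaw pg ps m s₀ t) (fun x => (x.1 : ℝ≥0∞)) ≠ ⊤ := fun t =>
    ne_top_of_le_ne_top (ENNReal.natCast_ne_top _) (expect_age_le pg ps m s₀ t)
  rw [avgAge, ENNReal.toReal_div, ENNReal.toReal_sum fun t _ => key t]
  simp [meanAge, mean]

lemma toReal_avgRate {T : ℕ} :
    (avgRate pg ps m s₀ T).toReal = (∑ t ∈ Finset.range T, meanRate pg ps m s₀ t) / T := by
  have key : ∀ t, expect (mixedSlotLaw pg ps m s₀ t) (fun x => if x.2 then 1 else 0) ≠ ⊤ := by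
    intro t
    simpa only [ofReal_actionValue] using
      linearGrowth_action.expect_ne_top (pg := pg) (ps := ps) (m := m) (s₀ := s₀) (t := t)
  rw [avgRate, ENNReal.toReal_div, ENNReal.toReal_sum fun t _ => key t]
  simp only [meanRate, mean, ofReal_actionValue, ENNReal.toReal_natCast]

/-! ### Poisson inequalities -/

/-- The one-slot inequality is averaged and telescoped. Having both weights `κ` and `μ` lets the
same lemma serve the pure rate (0, 1) and the priced cost (1, price). Requiring `H` only on the
support allows the action to be tied to the age under a threshold policy. -/
lemma sum_cost_ge_of_poisson {h : ℕ → ℝ} (hh : ∀ n, 0 ≤ h n)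
    (hg : LinearGrowth fun x => h x.1) {θ κ μ : ℝ} (hθ : 0 ≤ θ) (hκ : 0 ≤ κ) (hμ : 0 ≤ μ)
    (H : ∀ t, ∀ x ∈ (mixedSlotLaw pg ps m s₀ t).support,
      θ + h x.1 ≤ κ * x.1 + μ * actionValue x.2 + nextMean pg ps h x.1 x.2) (T : ℕ) :
    θ * T + h s₀ ≤ κ * ∑ t ∈ Finset.range T, meanAge pg ps m s₀ t +
      μ * ∑ t ∈ Finset.range T, meanRate pg ps m s₀ t + mean pg ps m s₀ T fun x => h x.1 := by
  induction T with
  | zero => simp [mean_zero hh]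
  | succ T ih =>
    have hA := linearGrowth_age.const_mul hκ
    have hr := linearGrowth_action.const_mul hμ
    have hA0 : ∀ x : ℕ × Bool, 0 ≤ κ * (x.1 : ℝ) := fun x => by positivity
    have hr0 : ∀ x : ℕ × Bool, 0 ≤ μ * actionValue x.2 :=
      fun x => mul_nonneg hμ (actionValue_nonneg _)
    have key := mean_mono_support ((hA.add hr).add (hg.nextMean (pg := pg) (ps := ps))) (H T)
    rw [mean_add (linearGrowth_of_le hθ fun _ => le_rfl) hg (fun _ => hθ) fun _ => hh _,
      mean_const hθ, mean_add (hA.add hr) hg.nextMean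
      (fun x => add_nonneg (hA0 x) (hr0 x)) (fun x => nextMean_nonneg _ _ hh _ _),
      mean_add hA hr hA0 hr0, mean_const_mul hκ, mean_const_mul hμ, ← mean_succ hh] at key
    rw [Finset.sum_range_succ, Finset.sum_range_succ, mul_add, mul_add]
    unfold meanAge meanRate at *
    push_cast
    linarith

lemma sum_cost_le_of_poisson {h : ℕ → ℝ} (hh : ∀ n, 0 ≤ h n)
    (hg : LinearGrowth fun x => h x.1) {θ κ μ : ℝ} (hθ : 0 ≤ θ) (hκ : 0 ≤ κ) (hμ : 0 ≤ μ)
    (H : ∀ t, ∀ x ∈ (mixedSlotLaw pg ps m s₀ t).support,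
      κ * x.1 + μ * actionValue x.2 + nextMean pg ps h x.1 x.2 ≤ θ + h x.1) (T : ℕ) :
    κ * ∑ t ∈ Finset.range T, meanAge pg ps m s₀ t +
      μ * ∑ t ∈ Finset.range T, meanRate pg ps m s₀ t + (mean pg ps m s₀ T fun x => h x.1) ≤
      θ * T + h s₀ := by
  induction T with
  | zero => simp [mean_zero hh]
  | succ T ih =>
    have hA := linearGrowth_age.const_mul hκ
    have hr := linearGrowth_action.const_mul hμ
    have hA0 : ∀ x : ℕ × Bool, 0 ≤ κ * (x.1 : ℝ) := fun x => by positivity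
    have hr0 : ∀ x : ℕ × Bool, 0 ≤ μ * actionValue x.2 :=
      fun x => mul_nonneg hμ (actionValue_nonneg _)
    have hθg : LinearGrowth fun _ => θ := linearGrowth_of_le hθ fun _ => le_rfl
    have key := mean_mono_support (hθg.add hg) (H T)
    rw [mean_add hθg hg (fun _ => hθ) fun _ => hh _,
      mean_const hθ, mean_add (hA.add hr) hg.nextMean
      (fun x => add_nonneg (hA0 x) (hr0 x)) (fun x => nextMean_nonneg _ _ hh _ _),
      mean_add hA hr hA0 hr0, mean_const_mul hκ, mean_const_mul hμ, ← mean_succ hh] at key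
    rw [Finset.sum_range_succ, Finset.sum_range_succ, mul_add, mul_add]
    unfold meanAge meanRate at *
    push_cast
    linarith

/-! ### The final version age is negligible -/

lemma mul_le_sum_add_sq {e : ℕ → ℝ} (h0 : ∀ t, 0 ≤ e t) (h1 : ∀ t, e (t + 1) ≤ e t + 1)
    {M T : ℕ} (hMT : M ≤ T) : M * e T ≤ ∑ t ∈ Finset.range T, e t + (M : ℝ) ^ 2 := by
  have grow : ∀ k j : ℕ, e (k + j) ≤ e k + j := by
    intro k j
    induction j with
    | zero => simp
    | succ j ih => rw [← add_assoc]; push_cast; linarith [h1 (k + j)]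
  obtain ⟨k, rfl⟩ := Nat.exists_eq_add_of_le' hMT
  rw [Finset.sum_range_add]
  -- Each of the last `M` terms before the final time lies at most `M` below the final value, since
  -- `e` gains at most one per step.
  have tail : ∑ _i ∈ Finset.range M, (e (k + M) - M) ≤ ∑ i ∈ Finset.range M, e (k + i) := by
    refine Finset.sum_le_sum fun i hi => ?_
    have hi : i ≤ M := (Finset.mem_range.1 hi).le
    have := grow (k + i) (M - i)
    rw [add_assoc, Nat.add_sub_cancel' hi, Nat.cast_sub hi] at this
    linarith [(Nat.cast_nonneg i : (0 : ℝ) ≤ i)]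
  rw [Finset.sum_const, Finset.card_range, nsmul_eq_mul] at tail
  have := Finset.sum_nonneg fun i (_ : i ∈ Finset.range k) => h0 i
  nlinarith

lemma eventually_meanAge_div_le (m : MixedPolicy) (s₀ : ℕ) {K ε : ℝ} (hε : 0 < ε) :
    ∀ᶠ T : ℕ in atTop, (avgAge pg ps m s₀ T).toReal ≤ K → meanAge pg ps m s₀ T / T ≤ ε := by
  -- In `M * e T ≤ K * T + M ^ 2`, this choice makes the first term at most half of `M * ε * T`;
  -- taking T large does the same for the second. The 1 keeps `M` positive for the final
  -- cancellation.
  obtain ⟨M, hM⟩ := exists_nat_gt (max 1 (2 * K / ε))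
  have hM1 : (1 : ℝ) < M := (le_max_left _ _).trans_lt hM
  have hM2 : 2 * K / ε < M := (le_max_right _ _).trans_lt hM
  have hlim : ∀ᶠ T : ℕ in atTop, (M : ℝ) / T < ε / 2 :=
    (tendsto_const_div_atTop_nhds_zero_nat (M : ℝ)).eventually_lt_const (by positivity)
  filter_upwards [hlim, eventually_ge_atTop M, eventually_gt_atTop 0] with T hT hTM hT0 hA
  have hT' : (0 : ℝ) < T := by exact_mod_cast hT0
  have key := mul_le_sum_add_sq (e := meanAge pg ps m s₀) (fun _ => mean_nonneg)
    (fun _ => meanAge_succ_le) hTM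
  rw [toReal_avgAge, div_le_iff₀ hT'] at hA
  rw [div_lt_iff₀ hT'] at hT
  rw [div_lt_iff₀ hε] at hM2
  rw [div_le_iff₀ hT']
  have : (M : ℝ) * meanAge pg ps m s₀ T ≤ M * (ε * T) := by nlinarith
  exact le_of_mul_le_mul_left this (by linarith)

/-! ### Update rate of a threshold policy -/

lemma R_zero (pg ps : ℝ) : R pg ps 0 = 1 := by simp [R]

lemma R_denom_pos {pg ps : ℝ} (hpg : 0 < pg) (hps : 0 < ps) (hps1 : ps ≤ 1) {n : ℕ}
    (hn : 1 ≤ n) : 0 < ((n : ℝ) - 1) * ps + (1 - (1 - ps) * (1 - pg)) := by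
  have : (1 : ℝ) ≤ n := by exact_mod_cast hn
  nlinarith [mul_nonneg (sub_nonneg.2 this) hps.le, mul_nonneg hpg.le (sub_nonneg.2 hps1)]

lemma R_of_pos (pg ps : ℝ) {n : ℕ} (hn : 1 ≤ n) :
    R pg ps n = pg / (((n : ℝ) - 1) * ps + (1 - (1 - ps) * (1 - pg))) := by
  rw [R, if_neg (by omega)]

lemma R_pos {pg ps : ℝ} (hpg : 0 < pg) (hps : 0 < ps) (hps1 : ps ≤ 1) (n : ℕ) :
    0 < R pg ps n := by
  rcases Nat.eq_zero_or_pos n with rfl | hn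
  · simp [R_zero]
  · rw [R_of_pos _ _ hn]
    exact div_pos hpg (R_denom_pos hpg hps hps1 hn)

/-- Relative value function for the update rate of the policy with threshold `n`. -/
def rateValue (pg ps : ℝ) (n Δ : ℕ) : ℝ := R pg ps n / pg * min Δ n

/-- Below n the idle equation forces increments `R n / pg`; from n on the value is constant. The
transmit equation then determines R(n). -/
lemma rateValue_poisson (hpg : (0 : ℝ) < pg) (hps : (0 : ℝ) < ps) (n Δ : ℕ) :
    R pg ps n + rateValue pg ps n Δ =
      actionValue (decide (n ≤ Δ)) + nextMean pg ps (rateValue pg ps n) Δ (decide (n ≤ Δ)) := by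
  rcases Nat.eq_zero_or_pos n with rfl | hn
  · simp [rateValue, nextMean, R_zero, actionValue]
  have hd := R_denom_pos hpg hps ps.2.2 hn
  by_cases hΔ : n ≤ Δ
  · have h1 : min Δ n = n := by omega
    have h2 : min (Δ + 1) n = n := by omega
    have h3 : min 1 n = 1 := by omega
    simp only [hΔ, decide_true, nextMean, step, Bool.and_self, Bool.and_false, if_true,
      Bool.false_eq_true, if_false, rateValue, actionValue, add_zero, zero_add, h1, h2, h3,
      Nat.zero_min, R_of_pos _ _ hn]
    field_simp
    push_cast
    ring
  · have h1 : min Δ n = Δ := by omega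
    have h2 : min (Δ + 1) n = Δ + 1 := by omega
    simp only [hΔ, decide_false, nextMean, step, Bool.false_and, if_true,
      Bool.false_eq_true, if_false, rateValue, actionValue, add_zero, zero_add, h1, h2]
    field_simp
    push_cast
    ring

lemma tendsto_toReal_avgRate_threshold (hpg : (0 : ℝ) < pg) (hps : (0 : ℝ) < ps) (n s₀ : ℕ) :
    Tendsto (fun T => (avgRate pg ps (PMF.pure (threshold n)) s₀ T).toReal) atTop
      (𝓝 (R pg ps n)) := by
  have hR := R_pos hpg hps ps.2.2 n
  have hu0 : ∀ Δ, 0 ≤ rateValue pg ps n Δ := fun Δ => by unfold rateValue; positivity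
  have hB0 : 0 ≤ R pg ps n / pg * n := by positivity
  have huB : ∀ Δ, rateValue pg ps n Δ ≤ R pg ps n / pg * n := fun Δ => by
    unfold rateValue
    gcongr
    exact min_le_right _ _
  have hug : LinearGrowth fun x => rateValue pg ps n x.1 :=
    linearGrowth_of_le hB0 fun x => huB x.1
  have heq : ∀ t, ∀ x ∈ (mixedSlotLaw pg ps (PMF.pure (threshold n)) s₀ t).support,
      R pg ps n + rateValue pg ps n x.1 = 0 * x.1 + 1 * actionValue x.2 +
        nextMean pg ps (rateValue pg ps n) x.1 x.2 := fun t x hx => by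
    rw [action_of_mem_support_threshold pg ps hx, rateValue_poisson hpg hps]
    ring
  have hge := sum_cost_ge_of_poisson hu0 hug hR.le le_rfl zero_le_one
    fun t x hx => (heq t x hx).le
  have hle := sum_cost_le_of_poisson hu0 hug hR.le le_rfl zero_le_one
    fun t x hx => (heq t x hx).ge
  have lim : ∀ c : ℝ, Tendsto (fun T : ℕ => R pg ps n + c / T) atTop (𝓝 (R pg ps n)) :=
    fun c => by simpa using (tendsto_const_div_atTop_nhds_zero_nat c).const_add (R pg ps n)
  refine tendsto_of_tendsto_of_tendsto_of_le_of_le'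
    (lim (rateValue pg ps n s₀ - R pg ps n / pg * n)) (lim (rateValue pg ps n s₀)) ?_ ?_
  all_goals
    filter_upwards [eventually_gt_atTop 0] with T hT
    have hT' : (0 : ℝ) < T := by exact_mod_cast hT
    rw [toReal_avgRate]
  · have hb : (mean pg ps (PMF.pure (threshold n)) s₀ T fun x => rateValue pg ps n x.1) ≤
        R pg ps n / pg * n := by
      rw [← mean_const (pg := pg) (ps := ps) (m := PMF.pure (threshold n)) (s₀ := s₀)
        (t := T) hB0]
      exact mean_mono_support (linearGrowth_of_le hB0 fun _ => le_rfl) fun x _ => huB x.1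
    rw [le_div_iff₀ hT', add_mul, div_mul_cancel₀ _ hT'.ne']
    linarith [hge T]
  · have hb := mean_nonneg (pg := pg) (ps := ps) (m := PMF.pure (threshold n)) (s₀ := s₀)
      (t := T) (f := fun x => rateValue pg ps n x.1)
    rw [div_le_iff₀ hT', add_mul, div_mul_cancel₀ _ hT'.ne']
    linarith [hle T]

/-! ### The Lagrangian problem -/

/-- Optimal average cost of the problem with cost `Δ + multiplier * a`, for the multiplier that
makes the thresholds `n` and `n + 1` both optimal. -/
def gain (pg ps : ℝ) (n : ℕ) : ℝ := n + pg / ps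

/-- The price of an update that makes the thresholds `n` and `n + 1` both optimal. -/
def multiplier (pg ps : ℝ) (n : ℕ) : ℝ := n * (1 - ps) + ps / pg * (n * (n + 1) / 2)

/-- Relative value function of the problem with cost `Δ + multiplier * a`. -/
def costValue (pg ps : ℝ) (n Δ : ℕ) : ℝ :=
  Δ / ps + (n * (min Δ n : ℕ) - (min Δ n : ℕ) * ((min Δ n : ℕ) - 1) / 2) / pg

lemma costValue_of_le (pg ps : ℝ) {n Δ : ℕ} (h : Δ ≤ n) :
    costValue pg ps n Δ = Δ / ps + (n * Δ - Δ * (Δ - 1) / 2) / pg := by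
  rw [costValue, min_eq_left h]

lemma costValue_of_ge (pg ps : ℝ) {n Δ : ℕ} (h : n ≤ Δ) :
    costValue pg ps n Δ = Δ / ps + (n * n - n * (n - 1) / 2) / pg := by
  rw [costValue, min_eq_right h]

lemma costValue_zero (pg ps : ℝ) (n : ℕ) : costValue pg ps n 0 = 0 := by
  simp [costValue]

/-- These increments are those for which idling balances: gain = Δ + pg · increment, with gain = n +
pg/ps. At Δ = n the increment is 1/ps, the constant slope beyond n, so the two regimes agree there.
-/
lemma costValue_succ_of_le (pg ps : ℝ) {n Δ : ℕ} (h : Δ ≤ n) :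
    costValue pg ps n (Δ + 1) = costValue pg ps n Δ + 1 / ps + (n - Δ) / pg := by
  rcases h.eq_or_lt with rfl | h
  · rw [costValue_of_ge _ _ le_rfl, costValue_of_ge _ _ (Nat.le_succ _)]
    push_cast
    ring
  · rw [costValue_of_le _ _ h.le, costValue_of_le _ _ h]
    push_cast
    ring

lemma costValue_succ_of_ge (pg ps : ℝ) {n Δ : ℕ} (h : n ≤ Δ) :
    costValue pg ps n (Δ + 1) = costValue pg ps n Δ + 1 / ps := by
  rw [costValue_of_ge _ _ h, costValue_of_ge _ _ (h.trans (Nat.le_succ _))]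
  push_cast
  ring

lemma costValue_one (pg ps : ℝ) (n : ℕ) : costValue pg ps n 1 = 1 / ps + n / pg := by
  simpa [costValue_zero] using costValue_succ_of_le pg ps (Nat.zero_le n)

lemma min_value_nonneg (n Δ : ℕ) :
    (0 : ℝ) ≤ n * (min Δ n : ℕ) - (min Δ n : ℕ) * ((min Δ n : ℕ) - 1) / 2 := by
  have : ((min Δ n : ℕ) : ℝ) ≤ n := by exact_mod_cast min_le_right _ _
  have h0 : (0 : ℝ) ≤ (min Δ n : ℕ) := Nat.cast_nonneg _
  nlinarith

lemma costValue_nonneg {pg ps : ℝ} (hpg : 0 < pg) (hps : 0 < ps) (n Δ : ℕ) :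
    0 ≤ costValue pg ps n Δ := by
  have := min_value_nonneg n Δ
  unfold costValue
  positivity

lemma costValue_le {pg ps : ℝ} (hpg : 0 < pg) (n Δ : ℕ) :
    costValue pg ps n Δ ≤ 1 / ps * Δ + (n * n + n) / pg := by
  have : ((min Δ n : ℕ) : ℝ) ≤ n := by exact_mod_cast min_le_right _ _
  have h0 : (0 : ℝ) ≤ (min Δ n : ℕ) := Nat.cast_nonneg _
  have hn : (0 : ℝ) ≤ n := Nat.cast_nonneg _
  have : (n * (min Δ n : ℕ) - (min Δ n : ℕ) * ((min Δ n : ℕ) - 1) / 2 : ℝ) ≤ n * n + n := by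
    nlinarith
  unfold costValue
  rw [div_mul_eq_mul_div, one_mul]
  gcongr

lemma linearGrowth_costValue {pg ps : ℝ} (hpg : 0 < pg) (hps : 0 < ps) (n : ℕ) :
    LinearGrowth fun x => costValue pg ps n x.1 := by
  refine ⟨1 / ps + (n * n + n) / pg, by positivity, fun x => (costValue_le hpg n x.1).trans ?_⟩
  have h1 : 0 ≤ 1 / ps := by positivity
  have h2 : 0 ≤ (n * n + n) / pg * x.1 := by positivity
  nlinarith

lemma nextMean_idle (h : ℕ → ℝ) (Δ : ℕ) :
    nextMean pg ps h Δ false = pg * h (Δ + 1) + (1 - pg) * h Δ := by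
  simp only [nextMean, step, Bool.false_and, Bool.false_eq_true, if_false, if_true, add_zero]
  ring

lemma nextMean_transmit (h : ℕ → ℝ) (Δ : ℕ) :
    nextMean pg ps h Δ true =
      ps * (pg * h 1 + (1 - pg) * h 0) + (1 - ps) * (pg * h (Δ + 1) + (1 - pg) * h Δ) := by
  simp [nextMean, step]

lemma poisson_idle_of_le (hpg : (0 : ℝ) < pg) {n Δ : ℕ} (h : Δ ≤ n) :
    gain pg ps n + costValue pg ps n Δ = Δ + nextMean pg ps (costValue pg ps n) Δ false := by
  rw [nextMean_idle, costValue_succ_of_le _ _ h, gain]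
  field_simp
  ring

lemma poisson_idle_of_ge {n Δ : ℕ} (h : n ≤ Δ) :
    gain pg ps n + costValue pg ps n Δ ≤ Δ + nextMean pg ps (costValue pg ps n) Δ false := by
  have : (n : ℝ) ≤ Δ := by exact_mod_cast h
  rw [nextMean_idle, costValue_succ_of_ge _ _ h, gain]
  ring_nf
  linarith

/-- The slope 1/ps cancels the dependence on Δ, and the remaining constant term fixes the price. -/
lemma poisson_transmit_of_ge (hpg : (0 : ℝ) < pg) (hps : (0 : ℝ) < ps) {n Δ : ℕ} (h : n ≤ Δ) :
    gain pg ps n + costValue pg ps n Δ =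
      Δ + multiplier pg ps n + nextMean pg ps (costValue pg ps n) Δ true := by
  rw [nextMean_transmit, costValue_succ_of_ge _ _ h, costValue_zero, costValue_one,
    costValue_of_ge _ _ h, gain, multiplier]
  field_simp
  ring

lemma poisson_transmit_of_le (hpg : (0 : ℝ) < pg) (hps : (0 : ℝ) < ps) {n Δ : ℕ} (h : Δ ≤ n) :
    gain pg ps n + costValue pg ps n Δ ≤
      Δ + multiplier pg ps n + nextMean pg ps (costValue pg ps n) Δ true := by
  have hx : (0 : ℝ) ≤ n - Δ := sub_nonneg.2 (by exact_mod_cast h)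
  have hs := sub_nonneg.2 ps.2.2
  have gap : Δ + multiplier pg ps n + nextMean pg ps (costValue pg ps n) Δ true =
      gain pg ps n + costValue pg ps n Δ +
        (ps / pg * ((n - Δ) * (n - Δ + 1) / 2) + (1 - ps) * (n - Δ)) := by
    rw [nextMean_transmit, costValue_succ_of_le _ _ h, costValue_zero, costValue_one,
      costValue_of_le _ _ h, gain, multiplier]
    field_simp
    ring
  rw [gap, le_add_iff_nonneg_right]
  positivity

lemma poisson_le (hpg : (0 : ℝ) < pg) (hps : (0 : ℝ) < ps) (n Δ : ℕ) (a : Bool) :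
    gain pg ps n + costValue pg ps n Δ ≤
      1 * Δ + multiplier pg ps n * actionValue a + nextMean pg ps (costValue pg ps n) Δ a := by
  rcases le_total n Δ with h | h <;> cases a
  · simpa [actionValue] using poisson_idle_of_ge h
  · simpa [actionValue] using (poisson_transmit_of_ge hpg hps h).le
  · simpa [actionValue] using (poisson_idle_of_le hpg h).le
  · simpa [actionValue] using poisson_transmit_of_le hpg hps h

lemma poisson_threshold (hpg : (0 : ℝ) < pg) (hps : (0 : ℝ) < ps) {n k : ℕ} (hnk : n ≤ k)
    (hkn : k ≤ n + 1) (Δ : ℕ) :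
    gain pg ps n + costValue pg ps n Δ = 1 * Δ + multiplier pg ps n *
      actionValue (decide (k ≤ Δ)) +
        nextMean pg ps (costValue pg ps n) Δ (decide (k ≤ Δ)) := by
  by_cases h : k ≤ Δ
  · simpa [actionValue, h] using poisson_transmit_of_ge hpg hps (hnk.trans h)
  · simpa [actionValue, h] using
      poisson_idle_of_le (ps := ps) hpg (show Δ ≤ n by omega)

lemma gain_nonneg {pg ps : ℝ} (hpg : 0 < pg) (hps : 0 < ps) (n : ℕ) : 0 ≤ gain pg ps n := by
  unfold gain; positivity

lemma multiplier_nonneg {pg ps : ℝ} (hpg : 0 < pg) (hps : 0 < ps) (hps1 : ps ≤ 1) (n : ℕ) :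
    0 ≤ multiplier pg ps n := by
  have := sub_nonneg.2 hps1
  unfold multiplier; positivity

lemma mean_costValue_div_le (hpg : (0 : ℝ) < pg) (hps : (0 : ℝ) < ps) (n : ℕ)
    (m : MixedPolicy) (s₀ T : ℕ) :
    (mean pg ps m s₀ T fun x => costValue pg ps n x.1) / T ≤
      1 / ps * (meanAge pg ps m s₀ T / T) + (n * n + n) / pg / T := by
  have hb : (0 : ℝ) ≤ (n * n + n) / pg := by positivity
  have hc : (0 : ℝ) ≤ 1 / ps := by positivity
  have hbg : LinearGrowth fun _ => ((n * n + n) / pg : ℝ) := linearGrowth_of_le hb fun _ => le_rfl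
  have h1 := linearGrowth_age.const_mul hc
  have : (mean pg ps m s₀ T fun x => costValue pg ps n x.1) ≤
      1 / ps * meanAge pg ps m s₀ T + (n * n + n) / pg := by
    rw [meanAge, ← mean_const_mul hc]
    rw [← mean_const (pg := pg) (ps := ps) (m := m) (s₀ := s₀) (t := T) hb]
    rw [← mean_add h1 hbg (fun x => by positivity) fun _ => hb]
    exact mean_mono_support (h1.add hbg) fun x _ => costValue_le hpg n x.1
  rw [← mul_div_assoc, ← add_div]
  gcongr

lemma tendsto_toReal_avgAge_threshold (hpg : (0 : ℝ) < pg) (hps : (0 : ℝ) < ps) {n k : ℕ}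
    (hnk : n ≤ k) (hkn : k ≤ n + 1) (s₀ : ℕ) :
    Tendsto (fun T => (avgAge pg ps (PMF.pure (threshold k)) s₀ T).toReal) atTop
      (𝓝 (gain pg ps n - multiplier pg ps n * R pg ps k)) := by
  set m : MixedPolicy := PMF.pure (threshold k)
  have hθ := gain_nonneg hpg hps n
  have hμ := multiplier_nonneg hpg hps ps.2.2 n
  have hh0 := costValue_nonneg hpg hps n
  have hhg := linearGrowth_costValue hpg hps n
  have heq : ∀ t, ∀ x ∈ (mixedSlotLaw pg ps m s₀ t).support,
      gain pg ps n + costValue pg ps n x.1 = 1 * x.1 + multiplier pg ps n * actionValue x.2 +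
        nextMean pg ps (costValue pg ps n) x.1 x.2 := fun t x hx => by
    rw [action_of_mem_support_threshold pg ps hx]
    exact poisson_threshold hpg hps hnk hkn x.1
  have hsum : ∀ T, 1 * ∑ t ∈ Finset.range T, meanAge pg ps m s₀ t + multiplier pg ps n *
      ∑ t ∈ Finset.range T, meanRate pg ps m s₀ t +
        (mean pg ps m s₀ T fun x => costValue pg ps n x.1) =
      gain pg ps n * T + costValue pg ps n s₀ := fun T => le_antisymm
    (sum_cost_le_of_poisson hh0 hhg hθ zero_le_one hμ (fun t x hx => (heq t x hx).ge) T)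
    (sum_cost_ge_of_poisson hh0 hhg hθ zero_le_one hμ (fun t x hx => (heq t x hx).le) T)
  have hH : Tendsto (fun T : ℕ => (mean pg ps m s₀ T fun x => costValue pg ps n x.1) / T)
      atTop (𝓝 0) := by
    -- Dropping the nonnegative rate and remainder terms from `hsum` bounds the average age, which
    -- is the hypothesis needed to make the final age negligible.
    have hbound : ∀ᶠ T : ℕ in atTop,
        (avgAge pg ps m s₀ T).toReal ≤ gain pg ps n + costValue pg ps n s₀ := by
      filter_upwards [eventually_gt_atTop 0] with T hT
      have hT' : (1 : ℝ) ≤ T := by exact_mod_cast hT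
      rw [toReal_avgAge, div_le_iff₀ (by linarith)]
      have h1 := mean_nonneg (pg := pg) (ps := ps) (m := m) (s₀ := s₀) (t := T)
        (f := fun x => costValue pg ps n x.1)
      have h2 : 0 ≤ multiplier pg ps n * ∑ t ∈ Finset.range T, meanRate pg ps m s₀ t :=
        mul_nonneg hμ (Finset.sum_nonneg fun _ _ => mean_nonneg)
      nlinarith [hsum T, hh0 s₀]
    have hage : Tendsto (fun T : ℕ => meanAge pg ps m s₀ T / T) atTop (𝓝 0) := by
      refine tendsto_order.2 ⟨fun a ha => Eventually.of_forall fun T => ha.trans_le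
        (div_nonneg mean_nonneg (Nat.cast_nonneg T)), fun a ha => ?_⟩
      filter_upwards [hbound, eventually_meanAge_div_le m s₀
        (K := gain pg ps n + costValue pg ps n s₀) (half_pos ha)] with T h1 h2
      linarith [h2 h1]
    refine squeeze_zero (fun T => div_nonneg mean_nonneg (Nat.cast_nonneg T))
      (fun T => mean_costValue_div_le hpg hps n m s₀ T) ?_
    simpa using (hage.const_mul (1 / (ps : ℝ))).add
      (tendsto_const_div_atTop_nhds_zero_nat ((n * n + n) / (pg : ℝ)))
  have hlim : Tendsto (fun T : ℕ => gain pg ps n + costValue pg ps n s₀ / T -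
      (mean pg ps m s₀ T fun x => costValue pg ps n x.1) / T -
        multiplier pg ps n * (avgRate pg ps m s₀ T).toReal) atTop
      (𝓝 (gain pg ps n + 0 - 0 - multiplier pg ps n * R pg ps k)) :=
    ((tendsto_const_nhds.add (tendsto_const_div_atTop_nhds_zero_nat _)).sub hH).sub
      ((tendsto_toReal_avgRate_threshold hpg hps k s₀).const_mul _)
  rw [add_zero, sub_zero] at hlim
  refine hlim.congr' ?_
  filter_upwards [eventually_gt_atTop 0] with T hT
  have hT' : (T : ℝ) ≠ 0 := by exact_mod_cast hT.ne'
  rw [toReal_avgAge, toReal_avgRate]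
  field_simp
  linarith [hsum T]

/-- Every policy that meets the rate constraint has at least the Lagrangian bound as its average
version age, up to an arbitrarily small error. -/
lemma eventually_lt_avgAge (hpg : (0 : ℝ) < pg) (hps : (0 : ℝ) < ps) {α : ℝ} (hα : 0 ≤ α)
    (hm : IsFeasible pg ps α s₀ m) (n : ℕ) {c : ℝ}
    (hc : c < gain pg ps n - multiplier pg ps n * α) :
    ∀ᶠ T in atTop, c < (avgAge pg ps m s₀ T).toReal := by
  have hθ := gain_nonneg hpg hps n
  have hμ := multiplier_nonneg hpg hps ps.2.2 n
  have hh0 := costValue_nonneg hpg hps n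
  have hhg := linearGrowth_costValue hpg hps n
  have hsum := sum_cost_ge_of_poisson (m := m) (s₀ := s₀) hh0 hhg hθ zero_le_one hμ
    fun t x _ => poisson_le hpg hps n x.1 x.2
  set δ := gain pg ps n - multiplier pg ps n * α - c with hδ
  have hδ0 : 0 < δ := by linarith
  have hq : (0 : ℝ) ≤ 1 / ps := by positivity
  -- The three summands pay for the excess rate, the linear part of the remainder and its constant
  -- part.
  set ε := δ / (2 * (multiplier pg ps n + 1 / ps + 1)) with hε
  have hε0 : 0 < ε := by positivity
  have hεδ : (multiplier pg ps n + 1 / ps + 1) * ε < δ := by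
    have : (multiplier pg ps n + 1 / ps + 1) * ε = δ / 2 := by
      rw [hε]; field_simp
    linarith
  have hrate : ∀ᶠ T in atTop, avgRate pg ps m s₀ T < ENNReal.ofReal (α + ε) := by
    refine eventually_lt_of_limsup_lt (lt_of_le_of_lt hm ?_)
    exact (ENNReal.ofReal_lt_ofReal_iff (by linarith)).2 (by linarith)
  have hconst : ∀ᶠ T : ℕ in atTop, ((n * n + n) / pg : ℝ) / T < ε :=
    (tendsto_const_div_atTop_nhds_zero_nat _).eventually_lt_const hε0
  filter_upwards [hrate, hconst, eventually_gt_atTop 0,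
    eventually_meanAge_div_le m s₀ (K := c) hε0] with T h1 h2 h3 h4
  -- If the average age exceeds c there is nothing to prove; otherwise `hcon` supplies the bound
  -- that makes the remainder small at this T.
  by_contra! hcon
  have h4 := mul_le_mul_of_nonneg_left (h4 hcon) hq
  have hT : (0 : ℝ) < T := by exact_mod_cast h3
  have h1 : (avgRate pg ps m s₀ T).toReal < α + ε :=
    (ENNReal.lt_ofReal_iff_toReal_lt avgRate_ne_top).1 h1
  have h5 := mean_costValue_div_le hpg hps n m s₀ T
  have h6 : gain pg ps n ≤ (avgAge pg ps m s₀ T).toReal +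
      multiplier pg ps n * (avgRate pg ps m s₀ T).toReal +
        (mean pg ps m s₀ T fun x => costValue pg ps n x.1) / T := by
    rw [toReal_avgAge, toReal_avgRate, ← mul_div_assoc, ← add_div, ← add_div, le_div_iff₀ hT]
    linarith [hsum T, hh0 s₀]
  have h7 := mul_le_mul_of_nonneg_left h1.le hμ
  linarith

/-! ### Limits of the averages -/

lemma tendsto_avgRate_threshold (hpg : (0 : ℝ) < pg) (hps : (0 : ℝ) < ps) (n s₀ : ℕ) :
    Tendsto (avgRate pg ps (PMF.pure (threshold n)) s₀) atTop
      (𝓝 (ENNReal.ofReal (R pg ps n))) := by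
  refine (ENNReal.tendsto_toReal_iff (fun _ => avgRate_ne_top) ENNReal.ofReal_ne_top).1 ?_
  rw [ENNReal.toReal_ofReal (R_pos hpg hps ps.2.2 n).le]
  exact tendsto_toReal_avgRate_threshold hpg hps n s₀

lemma thresholdCost_nonneg (hpg : (0 : ℝ) < pg) (hps : (0 : ℝ) < ps) {n k : ℕ}
    (hnk : n ≤ k) (hkn : k ≤ n + 1) : 0 ≤ gain pg ps n - multiplier pg ps n * R pg ps k :=
  ge_of_tendsto' (tendsto_toReal_avgAge_threshold hpg hps hnk hkn 0)
    fun _ => ENNReal.toReal_nonneg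

lemma tendsto_avgAge_threshold (hpg : (0 : ℝ) < pg) (hps : (0 : ℝ) < ps) {n k : ℕ}
    (hnk : n ≤ k) (hkn : k ≤ n + 1) (s₀ : ℕ) :
    Tendsto (avgAge pg ps (PMF.pure (threshold k)) s₀) atTop
      (𝓝 (ENNReal.ofReal (gain pg ps n - multiplier pg ps n * R pg ps k))) := by
  refine (ENNReal.tendsto_toReal_iff (fun _ => avgAge_ne_top) ENNReal.ofReal_ne_top).1 ?_
  rw [ENNReal.toReal_ofReal (thresholdCost_nonneg hpg hps hnk hkn)]
  exact tendsto_toReal_avgAge_threshold hpg hps hnk hkn s₀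

lemma avgAge_mixture (γ : unitInterval) (π₁ π₂ : Policy) (s₀ T : ℕ) :
    avgAge pg ps (mixture γ π₁ π₂) s₀ T =
      ENNReal.ofReal γ * avgAge pg ps (PMF.pure π₁) s₀ T +
        ENNReal.ofReal (1 - γ) * avgAge pg ps (PMF.pure π₂) s₀ T := by
  simp only [avgAge, expect_mixedSlotLaw_mixture, Finset.sum_add_distrib, ← Finset.mul_sum,
    ENNReal.add_div, mul_div_assoc]

lemma avgRate_mixture (γ : unitInterval) (π₁ π₂ : Policy) (s₀ T : ℕ) :
    avgRate pg ps (mixture γ π₁ π₂) s₀ T =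
      ENNReal.ofReal γ * avgRate pg ps (PMF.pure π₁) s₀ T +
        ENNReal.ofReal (1 - γ) * avgRate pg ps (PMF.pure π₂) s₀ T := by
  simp only [avgRate, expect_mixedSlotLaw_mixture, Finset.sum_add_distrib, ← Finset.mul_sum,
    ENNReal.add_div, mul_div_assoc]

lemma tendsto_convexComb {u v : ℕ → ℝ≥0∞} {a b : ℝ} (ha : 0 ≤ a) (hb : 0 ≤ b)
    (γ : unitInterval) (hu : Tendsto u atTop (𝓝 (ENNReal.ofReal a)))
    (hv : Tendsto v atTop (𝓝 (ENNReal.ofReal b))) :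
    Tendsto (fun T => ENNReal.ofReal γ * u T + ENNReal.ofReal (1 - γ) * v T) atTop
      (𝓝 (ENNReal.ofReal (γ * a + (1 - γ) * b))) := by
  have h1 := γ.2.1
  have h2 := sub_nonneg.2 γ.2.2
  rw [ENNReal.ofReal_add (by positivity) (by positivity), ENNReal.ofReal_mul h1,
    ENNReal.ofReal_mul h2]
  exact (ENNReal.Tendsto.const_mul hu (Or.inr ENNReal.ofReal_ne_top)).add
    (ENNReal.Tendsto.const_mul hv (Or.inr ENNReal.ofReal_ne_top))

lemma lagrangianBound_le_liminf (hpg : (0 : ℝ) < pg) (hps : (0 : ℝ) < ps) {α : ℝ}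
    (hα : 0 ≤ α) (hm : IsFeasible pg ps α s₀ m) (n : ℕ) :
    ENNReal.ofReal (gain pg ps n - multiplier pg ps n * α) ≤
      liminf (avgAge pg ps m s₀) atTop := by
  refine le_of_forall_lt_imp_le_of_dense fun c hc => ?_
  have hc' := hc.ne_top
  refine le_liminf_of_le (by isBoundedDefault) ?_
  filter_upwards [eventually_lt_avgAge hpg hps hα hm n
    ((ENNReal.lt_ofReal_iff_toReal_lt hc').1 hc)] with T hT
  exact ((ENNReal.toReal_lt_toReal hc' avgAge_ne_top).1 hT).le

/-! ### The optimal threshold -/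

lemma R_antitone {pg ps : ℝ} (hpg : 0 < pg) (hpg1 : pg ≤ 1) (hps : 0 < ps) (hps1 : ps ≤ 1) :
    Antitone (R pg ps) := by
  refine antitone_nat_of_succ_le fun n => ?_
  rcases Nat.eq_zero_or_pos n with rfl | hn
  · rw [R_zero, R_of_pos _ _ le_rfl, div_le_one (R_denom_pos hpg hps hps1 le_rfl)]
    push_cast
    nlinarith
  · rw [R_of_pos _ _ hn, R_of_pos _ _ (Nat.le_succ_of_le hn)]
    have := R_denom_pos hpg hps hps1 hn
    push_cast
    gcongr
    linarith

lemma R_succ_lt {pg ps : ℝ} (hpg : 0 < pg) (hps : 0 < ps) (hps1 : ps ≤ 1) {n : ℕ}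
    (hn : 1 ≤ n) : R pg ps (n + 1) < R pg ps n := by
  rw [R_of_pos _ _ hn, R_of_pos _ _ (Nat.le_succ_of_le hn)]
  have := R_denom_pos hpg hps hps1 hn
  push_cast
  gcongr
  linarith

lemma R_one_lt {pg ps : ℝ} (hpg : 0 < pg) (hpg1 : pg < 1) (hps : 0 < ps) (hps1 : ps ≤ 1) :
    R pg ps 1 < R pg ps 0 := by
  rw [R_zero, R_of_pos _ _ le_rfl, div_lt_one (R_denom_pos hpg hps hps1 le_rfl)]
  push_cast
  nlinarith

/-- The denominator of R(n) is n·ps + pg − pg·ps, so R(n) ≤ α is linear in n and its smallest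
solution is a ceiling. The value R(0) = 1 does not come from this formula, so n = 0 is excluded. -/
lemma R_le_iff {pg ps α : ℝ} (hpg : 0 < pg) (hps : 0 < ps) (hps1 : ps ≤ 1) (hα : 0 < α)
    {n : ℕ} (hn : 1 ≤ n) : R pg ps n ≤ α ↔ optThreshold pg ps α ≤ n := by
  rw [optThreshold, Nat.ceil_le, R_of_pos _ _ hn, div_le_iff₀ (R_denom_pos hpg hps hps1 hn),
    div_mul_eq_mul_div, div_le_iff₀ hps]
  have : pg * (1 / α - 1 + ps) = (pg - α * (pg - pg * ps)) / α := by
    field_simp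
    ring
  rw [this, div_le_iff₀ hα]
  constructor <;> intro h <;> nlinarith

lemma one_le_optThreshold {pg ps α : ℝ} (hpg : 0 < pg) (hps : 0 < ps) (hα : 0 < α)
    (hα1 : α ≤ 1) : 1 ≤ optThreshold pg ps α := by
  have : 1 ≤ 1 / α := (one_le_div hα).2 hα1
  have h : 0 < 1 / α - 1 + ps := by linarith
  exact Nat.ceil_pos.2 (by positivity)

/-- The limiting age of threshold policies is monotone in the threshold. -/
lemma thresholdCost_monotone (hpg : (0 : ℝ) < pg) (hps : (0 : ℝ) < ps) :
    Monotone fun n => ENNReal.ofReal (gain pg ps n - multiplier pg ps n * R pg ps n) := by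
  refine monotone_nat_of_le_succ fun n => ?_
  -- The limiting age of threshold n + 1 is re-expressed at the price for n, so that both sides
  -- share a price and only the rates differ.
  rw [tendsto_nhds_unique (tendsto_avgAge_threshold hpg hps le_rfl (Nat.le_succ _) 0)
    (tendsto_avgAge_threshold hpg hps (Nat.le_succ n) le_rfl 0)]
  refine ENNReal.ofReal_le_ofReal (sub_le_sub_left (mul_le_mul_of_nonneg_left ?_
    (multiplier_nonneg hpg hps ps.2.2 n)) _)
  exact R_antitone hpg pg.2.2 hps ps.2.2 (Nat.le_succ n)

end VAoI

end

theorem mainTheorem1 (pg ps : unitInterval) (α : ℝ)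
    (hpg : (0 : ℝ) < pg) (hps : (0 : ℝ) < ps) (hα : 0 < α) (hα1 : α ≤ 1)
    (hne : ¬ ((pg : ℝ) = 1 ∧ α = 1)) :
    -- `R(n)` is the long-run update rate of the policy with threshold `n`
    (∀ n s₀ : ℕ, Tendsto (VAoI.avgRate pg ps (PMF.pure (VAoI.threshold n)) s₀) atTop
      (𝓝 (ENNReal.ofReal (VAoI.R pg ps n)))) ∧
    -- the thresholds and the mixing probability are well defined
    1 ≤ VAoI.optThreshold pg ps α ∧
    VAoI.R pg ps (VAoI.optThreshold pg ps α) < VAoI.R pg ps (VAoI.optThreshold pg ps α - 1) ∧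
    -- the optimal threshold is best among the feasible single thresholds
    (∀ s₀ : ℕ,
      VAoI.IsFeasible pg ps α s₀ (PMF.pure (VAoI.threshold (VAoI.optThreshold pg ps α))) ∧
      ∀ n : ℕ, VAoI.IsFeasible pg ps α s₀ (PMF.pure (VAoI.threshold n)) →
        limsup (VAoI.avgAge pg ps
            (PMF.pure (VAoI.threshold (VAoI.optThreshold pg ps α))) s₀) atTop ≤
          liminf (VAoI.avgAge pg ps (PMF.pure (VAoI.threshold n)) s₀) atTop) ∧
    -- the mixture meets the constraint with equality and is optimal among all policies
    ∃ hγ : VAoI.optGamma pg ps α ∈ unitInterval, ∀ s₀ : ℕ,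
      Tendsto (VAoI.avgRate pg ps
          (VAoI.mixture ⟨VAoI.optGamma pg ps α, hγ⟩
            (VAoI.threshold (VAoI.optThreshold pg ps α))
            (VAoI.threshold (VAoI.optThreshold pg ps α - 1))) s₀) atTop
        (𝓝 (ENNReal.ofReal α)) ∧
      VAoI.IsOptimal pg ps α s₀
        (VAoI.mixture ⟨VAoI.optGamma pg ps α, hγ⟩
          (VAoI.threshold (VAoI.optThreshold pg ps α))
          (VAoI.threshold (VAoI.optThreshold pg ps α - 1))) := by
  have hps1 := ps.2.2
  have hN1 := VAoI.one_le_optThreshold hpg hps hα hα1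
  obtain ⟨n, hn⟩ : ∃ n, VAoI.optThreshold pg ps α = n + 1 :=
    Nat.exists_eq_add_of_le' hN1
  have hRle : VAoI.R pg ps (n + 1) ≤ α :=
    (VAoI.R_le_iff hpg hps hps1 hα (by omega)).2 hn.le
  have hleR : α ≤ VAoI.R pg ps n := by
    rcases Nat.eq_zero_or_pos n with rfl | hn0
    · rwa [VAoI.R_zero]
    · by_contra! h
      have := (VAoI.R_le_iff hpg hps hps1 hα hn0).1 h.le
      omega
  have hRlt : VAoI.R pg ps (n + 1) < VAoI.R pg ps n := by
    rcases Nat.eq_zero_or_pos n with rfl | hn0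
    · rcases pg.2.2.lt_or_eq with h | h
      · exact VAoI.R_one_lt hpg h hps hps1
      -- For pg = 1 one has R(1) = R(0) = 1, so strictness must come from α < 1.
      · have hα' : α < 1 := lt_of_le_of_ne hα1 fun h' => hne ⟨h, h'⟩
        refine (hRle.trans_lt hα').trans_eq (VAoI.R_zero _ _).symm
    · exact VAoI.R_succ_lt hpg hps hps1 hn0
  have hrate := VAoI.tendsto_avgRate_threshold hpg hps
  have hage := fun k => VAoI.tendsto_avgAge_threshold hpg hps (le_refl k) (Nat.le_succ k)
  have hage' := fun k => VAoI.tendsto_avgAge_threshold hpg hps (Nat.le_succ k) le_rfl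
  have hγ : VAoI.optGamma pg ps α ∈ unitInterval := by
    rw [VAoI.optGamma, hn, Nat.add_sub_cancel]
    have h := sub_pos.2 hRlt
    exact ⟨div_nonneg (by linarith) h.le, (div_le_one h).2 (by linarith)⟩
  have hγeq : VAoI.optGamma pg ps α * VAoI.R pg ps (n + 1) +
      (1 - VAoI.optGamma pg ps α) * VAoI.R pg ps n = α := by
    have h := (sub_pos.2 hRlt).ne'
    rw [VAoI.optGamma, hn, Nat.add_sub_cancel]
    field_simp
    ring
  refine ⟨hrate, hN1, by rwa [hn], fun s₀ => ⟨?_, fun k hk => ?_⟩, hγ, fun s₀ => ?_⟩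
  · rw [VAoI.IsFeasible, (hrate _ s₀).limsup_eq, hn]
    exact ENNReal.ofReal_le_ofReal hRle
  · rw [hn, (hage (n + 1) s₀).limsup_eq, (hage k s₀).liminf_eq]
    rw [VAoI.IsFeasible, (hrate _ s₀).limsup_eq, ENNReal.ofReal_le_ofReal_iff hα.le] at hk
    rcases Nat.eq_zero_or_pos k with rfl | hk0
    -- Always transmitting is feasible only for α = 1. Then the optimal threshold is 1, and the
    -- price for n = 0 vanishes, so thresholds 0 and 1 have the same limiting age.
    · have hα' : α = 1 := le_antisymm hα1 (by rwa [VAoI.R_zero] at hk)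
      have hn0 : n = 0 := by
        by_contra h0
        have h2 := (VAoI.R_antitone hpg pg.2.2 hps hps1 (Nat.zero_le 1))
        rw [VAoI.R_zero] at h2
        have := (VAoI.R_le_iff hpg hps hps1 hα le_rfl).1 (h2.trans hα'.ge)
        omega
      subst hn0
      rw [tendsto_nhds_unique (hage 1 s₀) (hage' 0 s₀)]
      simp [VAoI.multiplier]
    · exact VAoI.thresholdCost_monotone hpg hps
        (hn ▸ (VAoI.R_le_iff hpg hps hps1 hα hk0).1 hk)
  · rw [hn, Nat.add_sub_cancel]
    have hmix : Tendsto (VAoI.avgRate pg ps (VAoI.mixture ⟨VAoI.optGamma pg ps α, hγ⟩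
        (VAoI.threshold (n + 1)) (VAoI.threshold n)) s₀) atTop (𝓝 (ENNReal.ofReal α)) := by
      have key := VAoI.tendsto_convexComb (VAoI.R_pos hpg hps hps1 _).le
        (VAoI.R_pos hpg hps hps1 _).le ⟨VAoI.optGamma pg ps α, hγ⟩ (hrate (n + 1) s₀) (hrate n s₀)
      rwa [hγeq, ← funext (VAoI.avgRate_mixture _ _ _ s₀)] at key
    refine ⟨hmix, hmix.limsup_eq.le, (VAoI.gain pg ps n - VAoI.multiplier pg ps n * α).toNNReal,
      ?_, fun m' hm' => VAoI.lagrangianBound_le_liminf hpg hps hα.le hm' n⟩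
    have hJ : VAoI.gain pg ps n - VAoI.multiplier pg ps n * α =
        VAoI.optGamma pg ps α *
          (VAoI.gain pg ps n - VAoI.multiplier pg ps n * VAoI.R pg ps (n + 1)) +
        (1 - VAoI.optGamma pg ps α) *
          (VAoI.gain pg ps n - VAoI.multiplier pg ps n * VAoI.R pg ps n) := by
      -- At the common price the limiting age is affine in the rate, so the weights giving rate α
      -- give the Lagrangian bound.
      linear_combination VAoI.multiplier pg ps n * hγeq
    rw [hJ, funext (VAoI.avgAge_mixture _ _ _ s₀)]
    exact VAoI.tendsto_convexComb
      (VAoI.thresholdCost_nonneg hpg hps (Nat.le_succ n) le_rfl)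
      (VAoI.thresholdCost_nonneg hpg hps le_rfl (Nat.le_succ n)) _ (hage' n s₀) (hage n s₀)
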